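/- For an automorphism $\varphi$ of a group $G$, call $g_1,g_2\in G$ $\varphi$-twisted conjugate if $g_1=hg_2\varphi(h^{-1})$ for some $h\in G$, and let the Reidemeister number $R(\varphi)\in\{1,2,\dots\}\cup\{\infty\}$ be the number of $\varphi$-twisted conjugacy classes. Let $\widehat G_f$ be the set of (unitary) equivalence classes of finite-dimensional irreducible unitary complex representations of $G$, and let $\widehat\varphi\colon\widehat G_f\to\widehat G_f$, $\widehat\varphi([\rho])=[\rho\circ\varphi]$. We say that the finite-dimensional twisted Burnside--Frobenius theorem holds for $G$ if $R(\varphi)=\#\mathrm{Fix}(\widehat\varphi)$ for every automorphism $\varphi$ of $G$ with $R(\varphi)<\infty$. For positive integers $n,k$ let $\mathbb{Z}_n\operatorname{wr}\mathbb{Z}^k=\bigl(\bigoplus_{x\in\mathbb{Z}^k}(\mathbb{Z}_n)_x\bigr)\rtimes_\alpha\mathbb{Z}^k$ be the restricted wreath product, where $\alpha(h)$ maps the summand $(\mathbb{Z}_n)_x$ identically onto $(\mathbb{Z}_n)_{h+x}$. Theorem. Let $k$ and $n$ be positive integers. 1. If $\gcd(n,2)=1$, the finite-dimensional twisted Burnside--Frobenius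 theorem holds for $\mathbb{Z}_{3n}\operatorname{wr}\mathbb{Z}^{2k}$. 2. If $\gcd(n,6)=1$, the finite-dimensional twisted Burnside--Frobenius theorem holds for $\mathbb{Z}_{n}\operatorname{wr}\mathbb{Z}^{k}$. 3. These are exactly the cases in which $R(\varphi)$ can be finite: the group $\mathbb{Z}_n\operatorname{wr}\mathbb{Z}^k$ has an automorphism $\varphi$ with $R(\varphi)<\infty$ if and only if either $n=3m$ and $k=2l$ for some integers $m,l$ with $\gcd(m,2)=1$, or $\gcd(n,6)=1$. -/

import Mathlib

noncomputable section

namespace TwistedBurnside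

section Reidemeister

variable {G : Type*} [Group G]

/-- `g₁` and `g₂` are `φ`-twisted conjugate if `g₁ = h g₂ φ(h⁻¹)` for some `h`. -/
def twistedConj (φ : G ≃* G) : Setoid G where
  r g₁ g₂ := ∃ h : G, g₁ = h * g₂ * φ h⁻¹
  iseqv :=
    { refl := fun g => ⟨1, by simp⟩
      symm := by
        rintro g₁ g₂ ⟨h, rfl⟩
        exact ⟨h⁻¹, by simp [mul_assoc]⟩
      trans := by
        rintro g₁ g₂ g₃ ⟨h, rfl⟩ ⟨h', rfl⟩
        exact ⟨h * h', by simp [mul_assoc]⟩ }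

/-- The Reidemeister number `R(φ)`: the number of `φ`-twisted conjugacy classes. -/
def reidemeisterNumber (φ : G ≃* G) : ℕ∞ :=
  ENat.card (Quotient (twistedConj φ))

end Reidemeister

section UnitaryDual

/-- A finite-dimensional irreducible unitary representation of `G`. -/
structure UnitaryIrrep (G : Type*) [Group G] where
  /-- The underlying complex Hilbert space. -/
  V : Type
  [normed : NormedAddCommGroup V]
  [innerProduct : InnerProductSpace ℂ V]
  [finDim : FiniteDimensional ℂ V]
  /-- The action of `G`. -/
  ρ : Representation ℂ G V
  unitary : ∀ (g : G) (v w : V), inner ℂ (ρ g v) (ρ g w) = inner ℂ v w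
  irreducible : ρ.IsIrreducible

attribute [instance] UnitaryIrrep.normed UnitaryIrrep.innerProduct UnitaryIrrep.finDim

variable {G : Type*} [Group G]

/-- Unitary equivalence of representations. -/
def unitaryEquiv (G : Type*) [Group G] : Setoid (UnitaryIrrep G) where
  r π σ := ∃ T : π.V ≃ₗᵢ[ℂ] σ.V, ∀ (g : G) (v : π.V), T (π.ρ g v) = σ.ρ g (T v)
  iseqv :=
    { refl := fun π => ⟨LinearIsometryEquiv.refl ℂ π.V, fun _ _ => rfl⟩
      symm := by
        rintro π σ ⟨T, hT⟩
        refine ⟨T.symm, fun g v => ?_⟩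
        apply T.injective
        simp [hT]
      trans := by
        rintro π σ τ ⟨T, hT⟩ ⟨S, hS⟩
        exact ⟨T.trans S, fun g v => by simp [hT, hS]⟩ }

/-- The finite-dimensional part of the unitary dual: the set of equivalence classes of
finite-dimensional irreducible unitary representations. -/
def FinUnitaryDual (G : Type*) [Group G] :=
  Quotient (unitaryEquiv G)

/-- A representation and its composite with an automorphism have the same invariant subspaces. -/
def subrepresentationCompIso {V : Type*} [AddCommGroup V] [Module ℂ V]
    (ρ : Representation ℂ G V) (φ : G ≃* G) :
    Subrepresentation (MonoidHom.comp ρ φ.toMonoidHom : Representation ℂ G V) ≃o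
      Subrepresentation ρ where
  toFun W := ⟨W.toSubmodule, fun g v hv => by
    simpa using W.apply_mem_toSubmodule (φ.symm g) hv⟩
  invFun W := ⟨W.toSubmodule, fun g v hv => W.apply_mem_toSubmodule (φ g) hv⟩
  left_inv _ := rfl
  right_inv _ := rfl
  map_rel_iff' := Iff.rfl

/-- The representation `ρ ∘ φ`. -/
def UnitaryIrrep.comp (π : UnitaryIrrep G) (φ : G ≃* G) : UnitaryIrrep G where
  V := π.V
  ρ := MonoidHom.comp π.ρ φ.toMonoidHom
  unitary g v w := π.unitary (φ g) v w
  irreducible := (subrepresentationCompIso π.ρ φ).isSimpleOrder_iff.mpr π.irreducible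

/-- The map `[ρ] ↦ [ρ ∘ φ]` on the finite-dimensional part of the unitary dual. -/
def dualMap (φ : G ≃* G) : FinUnitaryDual G → FinUnitaryDual G :=
  Quotient.map (sa := unitaryEquiv G) (sb := unitaryEquiv G) (fun π => π.comp φ) (by
    rintro π σ ⟨T, hT⟩
    exact ⟨T, fun g v => hT (φ g) v⟩)

/-- The finite-dimensional twisted Burnside–Frobenius theorem holds for `G`: for every
automorphism `φ` with finite Reidemeister number, `R(φ)` equals the number of fixed points
of `[ρ] ↦ [ρ ∘ φ]`. -/
def TBFTf (G : Type*) [Group G] : Prop :=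
  ∀ φ : G ≃* G, reidemeisterNumber φ ≠ ⊤ →
    reidemeisterNumber φ = (Function.fixedPoints (dualMap φ)).encard

end UnitaryDual

section Wreath

/-- The action of `H` on `⨁_{x ∈ H} A_x` which sends the summand `A_x` to `A_{hx}`. -/
def shift (A H : Type*) [AddCommGroup A] [Group H] :
    H →* MulAut (Multiplicative (H →₀ A)) where
  toFun h := AddEquiv.toMultiplicative (Finsupp.domCongr (Equiv.mulLeft h))
  map_one' := by
    ext f x
    simp [Finsupp.equivMapDomain_apply]
    rfl
  map_mul' a b := by
    ext f x
    simp only [Equiv.mulLeft_mul, MulAut.mul_apply]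
    rfl

/-- The restricted wreath product `A wr H` of an (additively written) abelian group `A`
and a group `H`. -/
abbrev RestrictedWreath (A H : Type*) [AddCommGroup A] [Group H] :=
  Multiplicative (H →₀ A) ⋊[shift A H] H

/-- The lamplighter-type group `ℤ_n wr ℤ^k`. -/
abbrev Lamplighter (n k : ℕ) :=
  RestrictedWreath (ZMod n) (Multiplicative (Fin k → ℤ))

end Wreath

end TwistedBurnside

end

/-! The base of the wreath product is its torsion, so an automorphism `φ` induces `M` on ℤ^k and an
`M`-semilinear `ψ` on the base (`exists_isDecomposed`). If `R(φ)` is finite, then so is the group of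
coinvariants ℤ^k/(1 - M)ℤ^k. Hence `M` fixes no nonzero vector, and the twisted classes meeting the
coset over `x` are separated on it by the cokernel of `1 - t^x ψ`, which must be finite.

The key point is that this cokernel is finite only if it is zero. Modulo a prime `p ∣ n`, the group
algebra of ℤ^k has only trivial units, so `ψ` becomes `f ↦ c · t^a M f` (`exists_redMod_eq`). A
nonzero vector none of whose periods `s` under `M` satisfies `c ^ s ≠ 1` yields, through its
multiples, infinitely many disjoint orbits carrying invariant functionals, hence an infinite
cokernel (`IsDecomposed.exists_period`). Otherwise a geometric sum inverts `1 - t^x ψ` on each basis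
vector mod `p` (`IsMonomialMod.exists_redMod_eq`), and surjectivity modulo all `p ∣ n` gives
surjectivity (`mem_of_forall_prime_dvd`).

The twisted classes are then the fibres of the map to the finite abelian group of coinvariants. An
intertwiner `T` from `ρ` to `ρ ∘ φ` makes `g ↦ tr (T ρ(g))` a class function for twisted conjugacy,
so a fixed irreducible `ρ` factors through the coinvariants (`rho_eq_one_of_fixed`). Both sides of
the equality are therefore the order of that group.

For the classification, the condition `c ^ s ≠ 1` is impossible mod 2, and mod 3 it forces odd
periods, which requires even `k`. Conversely, `M = -1`, `c = 2` and `M` of order 3, `c = -1` give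
finite Reidemeister numbers. -/

open scoped TensorProduct

noncomputable section

namespace TwistedBurnside

/-! ### Matrix coefficients and characters -/

/-- A matrix coefficient `g ↦ tr (X ρ(g))` of a finite-dimensional irreducible complex
representation vanishes only for `X = 0`. -/
theorem eq_zero_of_trace_mul_eq_zero {G V : Type*} [Group G] [AddCommGroup V] [Module ℂ V]
    [FiniteDimensional ℂ V] (ρ : Representation ℂ G V) (hρ : ρ.IsIrreducible)
    (X : Module.End ℂ V) (hX : ∀ g, LinearMap.trace ℂ V (X * ρ g) = 0) : X = 0 := by
  have hspan : ∀ a : MonoidAlgebra ℂ G, LinearMap.trace ℂ V (X * ρ.asAlgebraHom a) = 0 := by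
    intro a
    induction a using MonoidAlgebra.induction_linear with
    | zero => simp
    | add x y hx hy => rw [map_add, mul_add, map_add, hx, hy, add_zero]
    | single g c => simp [hX]
  -- Burnside's theorem: by Schur the commutant is ℂ, so every `Y` is linear over it, and Jacobson
  -- density realises `Y` on a finite basis.
  have hdense : ∀ Y : Module.End ℂ V, ∃ a, ρ.asAlgebraHom a = Y := by
    intro Y
    have hs : IsSimpleModule (MonoidAlgebra ℂ G) ρ.asModule :=
      (Representation.irreducible_iff_isSimpleModule_asModule ρ).mp hρ
    let e := ρ.asModuleEquiv
    have : FiniteDimensional ℂ ρ.asModule := inferInstanceAs (FiniteDimensional ℂ V)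
    have hbij := IsSimpleModule.algebraMap_end_bijective_of_isAlgClosed (A := MonoidAlgebra ℂ G)
      (V := ρ.asModule) ℂ
    let f : Module.End (Module.End (MonoidAlgebra ℂ G) ρ.asModule) ρ.asModule :=
      { toFun := fun v => e.symm (Y (e v))
        map_add' := by simp
        map_smul' := by
          intro T v
          obtain ⟨c, rfl⟩ := hbij.2 T
          simp }
    let b := Module.finBasis ℂ V
    classical
    obtain ⟨r, hr⟩ := jacobson_density f (Finset.univ.image fun i => e.symm (b i))
    refine ⟨r, b.ext fun i => ?_⟩
    have := hr (e.symm (b i)) (Finset.mem_image_of_mem _ (Finset.mem_univ i))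
    have h2 := congrArg e this
    simpa [f, e] using h2.symm
  ext w
  refine (Module.forall_dual_apply_eq_zero_iff ℂ (X w)).1 fun f => ?_
  -- Testing against the rank-one operator `v ↦ f v • w` turns the trace into `f (X w)`.
  obtain ⟨a, ha⟩ := hdense (dualTensorHom ℂ V V (f ⊗ₜ w))
  have hcomp : X * dualTensorHom ℂ V V (f ⊗ₜ w) = dualTensorHom ℂ V V (f ⊗ₜ X w) := by
    ext v
    simp
  have := hspan a
  rw [ha, hcomp] at this
  simpa using this

/-- The one-dimensional unitary representation attached to a unitary character. -/
def charIrrep {G : Type*} [Group G] (χ : G →* ℂˣ) (hχ : ∀ g, ‖(χ g : ℂ)‖ = 1) :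
    UnitaryIrrep G where
  V := ℂ
  ρ := (Algebra.lmul ℂ ℂ : ℂ →* Module.End ℂ ℂ).comp ((Units.coeHom ℂ).comp χ)
  unitary g v w := by
    have h : (starRingEnd ℂ) (χ g : ℂ) * (χ g : ℂ) = 1 := by
      rw [Complex.conj_mul', hχ]
      simp
    change (χ g : ℂ) * w * (starRingEnd ℂ) ((χ g : ℂ) * v) = w * (starRingEnd ℂ) v
    rw [map_mul]
    linear_combination (w * (starRingEnd ℂ) v) * h
  irreducible :=
    { exists_pair_ne := ⟨⊥, ⊤, fun h => by
        have h' : (⊥ : Submodule ℂ ℂ) = ⊤ := congrArg Subrepresentation.toSubmodule h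
        exact bot_ne_top h'⟩
      eq_bot_or_eq_top := fun W => by
        rcases eq_bot_or_eq_top (α := Ideal ℂ) W.toSubmodule with h | h
        · exact Or.inl (Subrepresentation.toSubmodule_injective h)
        · exact Or.inr (Subrepresentation.toSubmodule_injective h) }

/-! ### Irreducible representations fixed by an automorphism -/

section Fixed

variable {G : Type*} [Group G]

/-- If `π` separates the twisted conjugacy classes of `φ`, then an irreducible representation
fixed by `φ` is trivial on the kernel of `π`. -/
theorem rho_eq_one_of_fixed {A : Type*} [CommGroup A] (φ : G ≃* G) (π : G →* A)
    (hc : ∀ g₁ g₂, π g₁ = π g₂ → ∃ h : G, g₁ = h * g₂ * φ h⁻¹) (σ : UnitaryIrrep G)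
    (hσ : (unitaryEquiv G).r (σ.comp φ) σ) (n : G) (hn : π n = 1) : σ.ρ n = 1 := by
  obtain ⟨S, hS⟩ := hσ
  let T : σ.V ≃ₗ[ℂ] σ.V := S.symm.toLinearEquiv
  have hT : ∀ g, σ.ρ (φ g) * (T : Module.End ℂ σ.V) = (T : Module.End ℂ σ.V) * σ.ρ g := by
    intro g
    ext v
    have := hS g (S.symm v)
    rw [S.apply_symm_apply] at this
    exact (S.symm_apply_eq.2 this.symm).symm
  -- By `hT` and cyclicity of the trace, `g ↦ tr (T ρ(g))` is constant on twisted classes, and `g *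
  -- n` and `g` share one.
  have htr : ∀ g, LinearMap.trace ℂ σ.V ((T : Module.End ℂ σ.V) * σ.ρ (g * n)) =
      LinearMap.trace ℂ σ.V ((T : Module.End ℂ σ.V) * σ.ρ g) := by
    intro g
    obtain ⟨h, hh⟩ := hc (g * n) g (by simp [hn])
    rw [hh, map_mul σ.ρ, ← mul_assoc, LinearMap.trace_mul_comm, ← mul_assoc, hT, mul_assoc,
      ← map_mul σ.ρ, inv_mul_cancel_left]
  have hzero : (σ.ρ n - 1) * (T : Module.End ℂ σ.V) = 0 := by
    refine eq_zero_of_trace_mul_eq_zero σ.ρ σ.irreducible _ fun g => ?_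
    rw [mul_assoc, LinearMap.trace_mul_comm, mul_assoc, mul_sub, ← map_mul σ.ρ, mul_one, mul_sub,
      map_sub, htr, sub_self]
  ext v
  have := LinearMap.congr_fun hzero (T.symm v)
  simpa [sub_eq_zero] using this

theorem UnitaryIrrep.nontrivial (σ : UnitaryIrrep G) : Nontrivial σ.V := by
  by_contra hV
  rw [not_nontrivial_iff_subsingleton] at hV
  obtain ⟨W₁, W₂, hW⟩ := σ.irreducible.exists_pair_ne
  exact hW (Subrepresentation.toSubmodule_injective (Subsingleton.elim _ _))

/-- An irreducible unitary representation with commuting values is given by a character. -/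
theorem exists_charIrrep_of_commute (σ : UnitaryIrrep G)
    (hcomm : ∀ g h, σ.ρ g * σ.ρ h = σ.ρ h * σ.ρ g) :
    ∃ (χ : G →* ℂˣ) (hχ : ∀ g, ‖(χ g : ℂ)‖ = 1),
      (unitaryEquiv G).r (charIrrep χ hχ) σ ∧ ∀ g v, σ.ρ g v = (χ g : ℂ) • v := by
  have hirr := σ.irreducible
  have hscal : ∀ g, ∃ c : ℂ, ∀ v, σ.ρ g v = c • v := by
    intro g
    let f : Representation.IntertwiningMap σ.ρ σ.ρ :=
      { toLinearMap := σ.ρ g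
        isIntertwining' := fun h => hcomm g h }
    obtain ⟨c, hc⟩ := (Representation.IsIrreducible.algebraMap_intertwiningMap_bijective_of_isAlgClosed
      (ρ := σ.ρ)).2 f
    refine ⟨c, fun v => ?_⟩
    have := DFunLike.congr_fun hc v
    have hv : (algebraMap ℂ (Representation.IntertwiningMap σ.ρ σ.ρ) c) v = c • v := by simp
    exact (hv.symm.trans this).symm
  choose c hc using hscal
  have hnt := σ.nontrivial
  -- A unit vector, so that `r ↦ r • v₀` is an isometry. Its line is invariant, hence everything.
  obtain ⟨v₀, hv₀⟩ := exists_norm_eq σ.V zero_le_one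
  have hv₀' : v₀ ≠ 0 := by
    rintro rfl
    simp at hv₀
  have hmul : ∀ g h, c (g * h) = c g * c h := by
    intro g h
    refine smul_left_injective ℂ hv₀' ?_
    simp only [← hc, map_mul, Module.End.mul_apply, mul_smul]
  have hone : c 1 = 1 := by
    refine smul_left_injective ℂ hv₀' ?_
    simp only [← hc, map_one, Module.End.one_apply, one_smul]
  let χ : G →* ℂˣ := MonoidHom.toHomUnits ⟨⟨c, hone⟩, hmul⟩
  have hχ : ∀ g, ‖(χ g : ℂ)‖ = 1 := by
    intro g
    have h := σ.unitary g v₀ v₀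
    rw [inner_self_eq_norm_sq_to_K, inner_self_eq_norm_sq_to_K, hc, norm_smul, hv₀, mul_one] at h
    have h' : ‖c g‖ ^ 2 = 1 ^ 2 := by exact_mod_cast h
    exact (pow_left_inj₀ (norm_nonneg _) zero_le_one two_ne_zero).1 h'

  let W : Subrepresentation σ.ρ :=
    { toSubmodule := Submodule.span ℂ {v₀}
      apply_mem_toSubmodule := fun g v hv => by
        rw [hc]
        exact Submodule.smul_mem _ _ hv }
  have hW : W.toSubmodule = ⊤ := by
    rcases hirr.eq_bot_or_eq_top W with h | h
    · refine absurd ?_ hv₀'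
      have : v₀ ∈ W.toSubmodule := Submodule.mem_span_singleton_self v₀
      rw [h] at this
      exact (Submodule.mem_bot ℂ).1 this
    · rw [h]
      rfl
  let S : ℂ →ₗᵢ[ℂ] σ.V :=
    { toLinearMap := LinearMap.toSpanSingleton ℂ σ.V v₀
      norm_map' := fun r => by simp [norm_smul, hv₀] }
  have hS : Function.Surjective S := fun v => by
    have : v ∈ W.toSubmodule := by rw [hW]; exact Submodule.mem_top
    exact Submodule.mem_span_singleton.1 this
  refine ⟨χ, hχ, ⟨LinearIsometryEquiv.ofSurjective S hS, fun g (v : ℂ) => ?_⟩, hc⟩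
  change ((χ g : ℂ) * v) • v₀ = σ.ρ g (v • v₀)
  rw [map_smul, hc, smul_smul, mul_comm]
  rfl

/-- If the twisted conjugacy classes are the fibres of a surjection onto a finite abelian group,
their number is the order of that group. -/
theorem reidemeisterNumber_eq_card {A : Type*} [CommGroup A] (φ : G ≃* G) (π : G →* A)
    (hs : Function.Surjective π) (hφ : ∀ g, π (φ g) = π g)
    (hc : ∀ g₁ g₂, π g₁ = π g₂ → ∃ h : G, g₁ = h * g₂ * φ h⁻¹) :
    reidemeisterNumber φ = ENat.card A := by
  refine ENat.card_congr (Equiv.ofBijective (Quotient.lift π ?_) ⟨?_, ?_⟩)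
  · rintro a b ⟨h, rfl⟩
    simp [hφ, mul_comm]
  · rintro ⟨a⟩ ⟨b⟩ h
    exact Quotient.sound (hc a b h)
  · intro a
    obtain ⟨g, rfl⟩ := hs a
    exact ⟨Quotient.mk _ g, rfl⟩

/-- If the twisted conjugacy classes are the fibres of a surjection onto a finite abelian group,
the representations fixed by the automorphism are the characters of that group. -/
theorem encard_fixedPoints_dualMap_eq_card {A : Type*} [CommGroup A] [Finite A] (φ : G ≃* G)
    (π : G →* A) (hs : Function.Surjective π) (hφ : ∀ g, π (φ g) = π g)
    (hc : ∀ g₁ g₂, π g₁ = π g₂ → ∃ h : G, g₁ = h * g₂ * φ h⁻¹) :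
    (Function.fixedPoints (dualMap φ)).encard = ENat.card A := by
  have hnorm : ∀ (χ : A →* ℂˣ) (g : G), ‖((χ.comp π) g : ℂ)‖ = 1 := fun χ g => by
    refine Complex.norm_eq_one_of_pow_eq_one (n := Nat.card A) ?_ Nat.card_pos.ne'
    rw [← Units.val_pow_eq_pow_val, MonoidHom.comp_apply, ← map_pow, pow_card_eq_one', map_one,
      Units.val_one]
  let F : (A →* ℂˣ) → FinUnitaryDual G := fun χ =>
    Quotient.mk (unitaryEquiv G) (charIrrep (χ.comp π) (hnorm χ))
  have hinj : Function.Injective F := by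
    intro χ₁ χ₂ h
    obtain ⟨T', hT'⟩ := Quotient.exact h
    let T : ℂ ≃ₗᵢ[ℂ] ℂ := T'
    have hT : ∀ (g : G) (v : ℂ), T ((χ₁ (π g) : ℂ) * v) = (χ₂ (π g) : ℂ) * T v := hT'
    ext a
    obtain ⟨g, rfl⟩ := hs a
    have h2 : T ((χ₁ (π g) : ℂ) * 1) = (χ₁ (π g) : ℂ) * T 1 := map_smul T _ (1 : ℂ)
    have h3 : T 1 ≠ 0 := fun h0 => one_ne_zero (T.injective (h0.trans (map_zero T).symm))
    exact mul_right_cancel₀ h3 (h2.symm.trans (hT g 1))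
  have hrange : Function.fixedPoints (dualMap φ) = Set.range F := by
    ext x
    constructor
    · induction x using Quotient.inductionOn with | _ σ =>
      intro hσ
      have hr : (unitaryEquiv G).r (σ.comp φ) σ := Quotient.exact hσ
      have hker := rho_eq_one_of_fixed φ π hc σ hr
      have hfac : ∀ g h, π g = π h → σ.ρ g = σ.ρ h := by
        intro g h hgh
        have : σ.ρ (g * h⁻¹) = 1 := hker _ (by simp [hgh])
        rw [← inv_mul_cancel_right g h, map_mul, this, one_mul]
      obtain ⟨χ, hχ, heq, hsm⟩ := exists_charIrrep_of_commute σ fun g h => by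
        rw [← map_mul, ← map_mul]
        exact hfac _ _ (by rw [map_mul, map_mul, mul_comm])
      have hχker : π.ker ≤ χ.ker := by
        intro g hg
        have hnt := σ.nontrivial
        obtain ⟨v, hv⟩ := exists_ne (0 : σ.V)
        refine Units.ext (smul_left_injective ℂ hv ?_)
        simp only [← hsm, hker g hg, Units.val_one, one_smul, Module.End.one_apply]
      let χ' : A →* ℂˣ := (QuotientGroup.lift π.ker χ hχker).comp
        (QuotientGroup.quotientKerEquivOfSurjective π hs).symm.toMonoidHom
      have hχ' : χ'.comp π = χ := by
        ext g
        have : (QuotientGroup.quotientKerEquivOfSurjective π hs).symm (π g) = (g : G ⧸ π.ker) :=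
          (MulEquiv.symm_apply_eq _).2 rfl
        simp [χ', this]
      refine ⟨χ', Quotient.sound ?_⟩
      have hcongr : charIrrep (χ'.comp π) (hnorm χ') = charIrrep χ hχ := by
        congr
      change (unitaryEquiv G).r _ _
      rw [hcongr]
      exact heq
    · rintro ⟨χ, rfl⟩
      refine Quotient.sound ⟨LinearIsometryEquiv.refl ℂ ℂ, fun g (v : ℂ) => ?_⟩
      change ((χ (π (φ g)) : ℂˣ) : ℂ) * v = ((χ (π g) : ℂˣ) : ℂ) * v
      rw [hφ]
  -- A finite abelian group has as many complex characters as elements.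
  rw [hrange, ← Set.image_univ, hinj.encard_image, Set.encard_univ,
    ENat.card_congr (CommGroup.monoidHom_mulEquiv_of_hasEnoughRootsOfUnity A ℂ).some.toEquiv]

end Fixed

open SemidirectProduct

/-! ### Automorphisms of the wreath product in terms of `M` and `ψ` -/

section Decomposition

variable {A H : Type*} [AddCommGroup A] [CommGroup H]

/-- Translation by `x` on `⨁_{y ∈ H} A_y`, written additively. -/
def translate (x : H) : (H →₀ A) ≃+ (H →₀ A) := Finsupp.domCongr (Equiv.mulLeft x)

@[simp]
theorem translate_single (x y : H) (r : A) :
    translate x (Finsupp.single y r) = Finsupp.single (x * y) r := by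
  simp [translate, Finsupp.equivMapDomain_single]

theorem translate_eq_mapDomain (x : H) (f : H →₀ A) :
    translate x f = Finsupp.mapDomain (x * ·) f := by
  simp [translate, Finsupp.equivMapDomain_eq_mapDomain]

theorem shift_ofAdd (x : H) (f : H →₀ A) :
    shift A H x (Multiplicative.ofAdd f) = Multiplicative.ofAdd (translate x f) := rfl

/-- The inclusion of the base group, from additive notation. -/
def lamp (f : H →₀ A) : RestrictedWreath A H := inl (Multiplicative.ofAdd f)

theorem lamp_add (f g : H →₀ A) : lamp (f + g) = lamp f * lamp g := map_mul inl _ _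

theorem lamp_neg (f : H →₀ A) : lamp (-f) = (lamp f)⁻¹ := map_inv inl _

@[simp]
theorem lamp_zero : lamp (0 : H →₀ A) = 1 := map_one inl

@[simp]
theorem lamp_right (f : H →₀ A) : (lamp f).right = 1 := rfl

theorem lamp_injective : Function.Injective (lamp : (H →₀ A) → RestrictedWreath A H) :=
  fun _ _ h => Multiplicative.ofAdd.injective (inl_injective h)

theorem exists_lamp_of_right_eq_one (g : RestrictedWreath A H) (hg : g.right = 1) :
    ∃ f, g = lamp f :=
  ⟨Multiplicative.toAdd g.left, SemidirectProduct.ext rfl hg⟩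

/-- Conjugation on the base group is translation. -/
theorem mul_lamp (g : RestrictedWreath A H) (f : H →₀ A) :
    g * lamp f = lamp (translate g.right f) * g := by
  ext1
  · simp only [lamp, mul_left, left_inl, right_inl, map_one, MulAut.one_apply, shift_ofAdd]
    rw [mul_comm]
  · simp [lamp]

/-- The action of an automorphism of the wreath product on the quotient `H` and on the base. -/
structure IsDecomposed (φ : RestrictedWreath A H ≃* RestrictedWreath A H)
    (M : MulAut H) (ψ : (H →₀ A) ≃+ (H →₀ A)) : Prop where
  map_right (g : RestrictedWreath A H) : (φ g).right = M g.right
  map_lamp (f : H →₀ A) : φ (lamp f) = lamp (ψ f)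

/-- Apply `φ` to the relation expressing translation as conjugation by `inr y`. This is the
`M`-semilinearity of `ψ` over the group ring of `H`. -/
theorem IsDecomposed.map_translate {φ : RestrictedWreath A H ≃* RestrictedWreath A H}
    {M : MulAut H} {ψ : (H →₀ A) ≃+ (H →₀ A)} (hφ : IsDecomposed φ M ψ) (y : H) (f : H →₀ A) :
    ψ (translate y f) = translate (M y) (ψ f) := by
  have h := congrArg φ (mul_lamp (inr y : RestrictedWreath A H) f)
  rw [map_mul, map_mul, hφ.map_lamp, hφ.map_lamp, mul_lamp, right_inr, hφ.map_right, right_inr] at h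
  exact (lamp_injective (mul_right_cancel h)).symm

/-- Over a torsion-free abelian group, the base of a wreath product with finite exponent is
characteristic, so that every automorphism decomposes. -/
theorem exists_isDecomposed [IsMulTorsionFree H] {n : ℕ} (hn : n ≠ 0) (hA : ∀ a : A, n • a = 0)
    (φ : RestrictedWreath A H ≃* RestrictedWreath A H) :
    ∃ M ψ, IsDecomposed φ M ψ := by
  -- Base elements are killed by `n` and `H` is torsion-free. The automorphism is quantified so that
  -- `φ.symm` is covered too.
  have key : ∀ (φ : RestrictedWreath A H ≃* RestrictedWreath A H) (f : H →₀ A),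
      (φ (lamp f)).right = 1 := by
    intro φ f
    have h0 : n • f = 0 := by
      ext x
      simp [hA]
    have h1 : lamp f ^ n = 1 := by
      have h := map_pow (inl : _ →* RestrictedWreath A H) (Multiplicative.ofAdd f) n
      rw [← ofAdd_nsmul, h0] at h
      exact h.symm.trans (map_one inl)
    have h2 : (φ (lamp f)).right ^ n = 1 := by
      have h := map_pow (rightHom : RestrictedWreath A H →* H) (φ (lamp f)) n
      rw [← map_pow, h1, map_one, map_one] at h
      exact h.symm
    exact (pow_eq_one_iff_left hn).1 h2
  have hright : ∀ (φ : RestrictedWreath A H ≃* RestrictedWreath A H) (g : RestrictedWreath A H),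
      (φ g).right = (φ (inr g.right)).right := by
    intro φ g
    conv_lhs => rw [← inl_left_mul_inr_right g, map_mul, mul_right]
    rw [show (φ (inl g.left)).right = 1 from key φ (Multiplicative.toAdd g.left), one_mul]
  choose ψ hψ using fun f => exists_lamp_of_right_eq_one _ (key φ f)
  choose ψ' hψ' using fun f => exists_lamp_of_right_eq_one _ (key φ.symm f)
  let M : MulAut H :=
    { toFun := fun x => (φ (inr x)).right
      invFun := fun x => (φ.symm (inr x)).right
      left_inv := fun x => by simp [← hright]
      right_inv := fun x => by simp [← hright]
      map_mul' := fun x y => by simp }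
  let Ψ : (H →₀ A) ≃+ (H →₀ A) :=
    { toFun := ψ
      invFun := ψ'
      left_inv := fun f => lamp_injective (by rw [← hψ', ← hψ]; simp)
      right_inv := fun f => lamp_injective (by rw [← hψ, ← hψ']; simp)
      map_add' := fun f g => lamp_injective (by rw [← hψ, lamp_add, lamp_add, map_mul, hψ, hψ]) }
  exact ⟨M, Ψ, ⟨hright φ, hψ⟩⟩

/-! ### Twisted conjugacy classes and coinvariants -/

section Classes

variable {φ : RestrictedWreath A H ≃* RestrictedWreath A H} {M : MulAut H}
  {ψ : (H →₀ A) ≃+ (H →₀ A)}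

/-- The subgroup of all `z / M z`. -/
def coboundaries (M : MulAut H) : Subgroup H := (MonoidHom.id H / M.toMonoidHom).range

theorem mem_coboundaries {M : MulAut H} {x : H} : x ∈ coboundaries M ↔ ∃ z, z / M z = x :=
  Iff.rfl

/-- The projection of the wreath product to the coinvariants of `M`. -/
def toCoinvariants (A : Type*) [AddCommGroup A] (M : MulAut H) :
    RestrictedWreath A H →* H ⧸ coboundaries M :=
  (QuotientGroup.mk' (coboundaries M)).comp rightHom

theorem toCoinvariants_surjective : Function.Surjective (toCoinvariants A M) :=
  (QuotientGroup.mk'_surjective _).comp rightHom_surjective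

theorem IsDecomposed.toCoinvariants_apply (hφ : IsDecomposed φ M ψ)
    (g : RestrictedWreath A H) : toCoinvariants A M (φ g) = toCoinvariants A M g := by
  change ((φ g).right : H ⧸ coboundaries M) = (g.right : H ⧸ coboundaries M)
  rw [hφ.map_right, QuotientGroup.eq, mem_coboundaries]
  exact ⟨g.right, by rw [div_eq_mul_inv, mul_comm]⟩

/-- If every `1 - t^x ψ` is surjective, twisted conjugacy is detected by the coinvariants. -/
theorem IsDecomposed.exists_conj (hφ : IsDecomposed φ M ψ)
    (hsurj : ∀ (x : H) (d : H →₀ A), ∃ f, f - translate x (ψ f) = d)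
    (g₁ g₂ : RestrictedWreath A H) (h : toCoinvariants A M g₁ = toCoinvariants A M g₂) :
    ∃ h, g₁ = h * g₂ * φ h⁻¹ := by
  -- Conjugating `g₂` by `inr z` matches the components in `H`. The remaining discrepancy `d` lies
  -- in the base and is absorbed by solving `f - t^x ψ f = -d` for `x = g₁.right`.
  obtain ⟨z, hz⟩ := mem_coboundaries.1 (QuotientGroup.eq.1 h.symm)
  have hz' : (inr z * g₂ * φ (inr z)⁻¹ * g₁⁻¹).right = 1 := by
    simp only [mul_right, inv_right, hφ.map_right, right_inr, map_inv]
    change z / M z = g₂.right⁻¹ * g₁.right at hz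
    rw [div_eq_mul_inv] at hz
    rw [mul_right_comm z, hz]
    simp [mul_comm]
  obtain ⟨d, hd⟩ := exists_lamp_of_right_eq_one _ hz'
  obtain ⟨f, hf⟩ := hsurj g₁.right (-d)
  refine ⟨lamp f * inr z, ?_⟩
  have hd' : inr z * g₂ * φ (inr z)⁻¹ = lamp d * g₁ := by rw [← hd]; group
  calc g₁ = lamp (f + d - translate g₁.right (ψ f)) * g₁ := by
        rw [add_sub_right_comm, hf, neg_add_cancel, lamp_zero, one_mul]
    _ = lamp f * lamp d * (g₁ * lamp (-ψ f)) := by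
        rw [mul_lamp g₁, map_neg, sub_eq_add_neg, lamp_add, lamp_add, mul_assoc]
    _ = lamp f * inr z * g₂ * φ (lamp f * inr z)⁻¹ := by
        rw [mul_inv_rev, map_mul, ← lamp_neg, hφ.map_lamp, map_neg, mul_assoc (lamp f) (lamp d),
          ← mul_assoc (lamp d), ← hd']
        simp only [mul_assoc]

/-- If `M` has no nontrivial fixed points, twisted conjugacy of elements over the same `x`
is congruence modulo the image of `1 - t^x ψ`. -/
theorem IsDecomposed.exists_sub_eq (hφ : IsDecomposed φ M ψ) (hM : ∀ z, M z = z → z = 1)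
    (x : H) (d₁ d₂ : H →₀ A)
    (h : ∃ h, lamp d₁ * inr x = h * (lamp d₂ * inr x) * φ h⁻¹) :
    ∃ f, f - translate x (ψ f) = d₁ - d₂ := by
  obtain ⟨h, hh⟩ := h
  have hr := congrArg SemidirectProduct.right hh
  simp only [mul_right, lamp_right, right_inr, hφ.map_right, inv_right, map_inv, one_mul] at hr
  -- Comparing components in `H` shows that `M` fixes `h.right`, so the conjugator lies in the base.
  have h1 : h.right = 1 := by
    refine hM _ ?_
    rw [mul_right_comm, right_eq_mul, mul_inv_eq_one] at hr
    exact hr.symm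
  obtain ⟨f, rfl⟩ := exists_lamp_of_right_eq_one h h1
  refine ⟨f, ?_⟩
  rw [← lamp_neg, hφ.map_lamp, mul_assoc, mul_assoc, mul_lamp, ← mul_assoc, ← mul_assoc,
    ← lamp_add, ← lamp_add] at hh
  have := lamp_injective (mul_right_cancel hh)
  rw [this, right_inr, map_neg, map_neg]
  abel

/-- The projection to the coinvariants is onto and constant on twisted classes. -/
theorem IsDecomposed.finite_coinvariants (hφ : IsDecomposed φ M ψ)
    (hR : reidemeisterNumber φ ≠ ⊤) : Finite (H ⧸ coboundaries M) := by
  have : Finite (Quotient (twistedConj φ)) := ENat.card_lt_top.1 hR.lt_top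
  refine Finite.of_surjective (α := Quotient (twistedConj φ))
    (Quotient.lift (toCoinvariants A M) ?_) fun a => ?_
  · rintro a b ⟨h, rfl⟩
    rw [map_mul, map_mul, hφ.toCoinvariants_apply, map_inv, mul_inv_cancel_comm]
  · obtain ⟨g, rfl⟩ := toCoinvariants_surjective (A := A) a
    exact ⟨Quotient.mk _ g, rfl⟩

/-- A finite Reidemeister number makes every `1 - t^x ψ` have finite cokernel. -/
theorem IsDecomposed.exists_ne_sub_eq (hφ : IsDecomposed φ M ψ) (hM : ∀ z, M z = z → z = 1)
    (hR : reidemeisterNumber φ ≠ ⊤) (x : H) (d : ℕ → H →₀ A) :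
    ∃ i j, i ≠ j ∧ ∃ f, f - translate x (ψ f) = d i - d j := by
  have : Finite (Quotient (twistedConj φ)) := ENat.card_lt_top.1 hR.lt_top
  obtain ⟨i, j, hij, h⟩ := Finite.exists_ne_map_eq_of_infinite
    fun i => Quotient.mk (twistedConj φ) (lamp (d i) * inr x)
  exact ⟨i, j, hij, hφ.exists_sub_eq hM x _ _ (Quotient.exact h)⟩

theorem IsDecomposed.reidemeisterNumber_eq (hφ : IsDecomposed φ M ψ)
    (hsurj : ∀ (x : H) (d : H →₀ A), ∃ f, f - translate x (ψ f) = d) :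
    reidemeisterNumber φ = ENat.card (H ⧸ coboundaries M) :=
  reidemeisterNumber_eq_card φ (toCoinvariants A M) toCoinvariants_surjective
    hφ.toCoinvariants_apply (hφ.exists_conj hsurj)

theorem IsDecomposed.encard_fixedPoints_eq (hφ : IsDecomposed φ M ψ)
    [Finite (H ⧸ coboundaries M)]
    (hsurj : ∀ (x : H) (d : H →₀ A), ∃ f, f - translate x (ψ f) = d) :
    (Function.fixedPoints (dualMap φ)).encard = ENat.card (H ⧸ coboundaries M) :=
  encard_fixedPoints_dualMap_eq_card φ (toCoinvariants A M) toCoinvariants_surjective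
    hφ.toCoinvariants_apply (hφ.exists_conj hsurj)

end Classes

end Decomposition

/-! ### Units of group algebras and reduction modulo primes -/

section Reduction

/-- The group algebra of a group with two unique products over a field has only trivial units. -/
theorem exists_eq_single_of_mul_eq_one {K H : Type*} [Field K] [Group H] [TwoUniqueProds H]
    {u v : MonoidAlgebra K H} (h : u * v = 1) :
    ∃ (a : H) (c : Kˣ), u = MonoidAlgebra.single a (c : K) := by
  classical
  have hu : u.coeff.support.Nonempty := by
    rw [Finsupp.support_nonempty_iff]
    rintro h0
    have : u = 0 := MonoidAlgebra.coeff_eq_zero.1 h0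
    simp [this] at h
  have hv : v.coeff.support.Nonempty := by
    rw [Finsupp.support_nonempty_iff]
    rintro h0
    have : v = 0 := MonoidAlgebra.coeff_eq_zero.1 h0
    simp [this] at h
  -- Otherwise there are two distinct unique products. Each gives a nonzero coefficient of `u * v =
  -- 1`, so both products equal the identity, contradicting uniqueness.
  have hcard : u.coeff.support.card * v.coeff.support.card ≤ 1 := by
    by_contra hlt
    obtain ⟨q₁, hq₁, q₂, hq₂, hne, hU₁, hU₂⟩ :=
      TwoUniqueProds.uniqueMul_of_one_lt_card (not_le.1 hlt)
    have key : ∀ q ∈ u.coeff.support ×ˢ v.coeff.support,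
        UniqueMul u.coeff.support v.coeff.support q.1 q.2 → q.1 * q.2 = 1 := by
      intro q hq hU
      have h1 := MonoidAlgebra.coeff_mul_mul_of_uniqueMul hU
      rw [Finset.mem_product, Finsupp.mem_support_iff, Finsupp.mem_support_iff] at hq
      by_contra hq1
      rw [h, MonoidAlgebra.one_def, MonoidAlgebra.coeff_single,
        Finsupp.single_eq_of_ne hq1] at h1
      exact mul_ne_zero hq.1 hq.2 h1.symm
    have heq := (key q₂ hq₂ hU₂).trans (key q₁ hq₁ hU₁).symm
    rw [Finset.mem_product] at hq₂
    have := hU₁ hq₂.1 hq₂.2 heq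
    exact hne (Prod.ext this.1.symm this.2.symm)
  have hone : u.coeff.support.card = 1 := by
    have h1 := hu.card_pos
    have h2 := hv.card_pos
    nlinarith
  obtain ⟨a, c, hc, huc⟩ := Finsupp.card_support_eq_one'.1 hone
  exact ⟨a, Units.mk0 c hc, MonoidAlgebra.coeff_injective huc⟩

theorem coeff_single_mul_ofCoeff {K H : Type*} [Semiring K] [Mul H] (a : H) (c : K)
    (g : H →₀ K) : (MonoidAlgebra.single a c * MonoidAlgebra.ofCoeff g).coeff =
      c • Finsupp.mapDomain (a * ·) g := by
  induction g using Finsupp.induction_linear with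
  | zero => simp
  | add f g hf hg =>
    rw [MonoidAlgebra.ofCoeff_add, mul_add, MonoidAlgebra.coeff_add, hf, hg,
      Finsupp.mapDomain_add, smul_add]
  | single y r =>
    rw [MonoidAlgebra.ofCoeff_single, MonoidAlgebra.single_mul_single,
      MonoidAlgebra.coeff_single, Finsupp.mapDomain_single, Finsupp.smul_single, smul_eq_mul]

variable {H : Type*} {n p : ℕ}

/-- Reduction of coefficients modulo a divisor. -/
def redMod (H : Type*) (hpn : p ∣ n) : (H →₀ ZMod n) →+ (H →₀ ZMod p) :=
  Finsupp.mapRange.addMonoidHom (ZMod.castHom hpn (ZMod p)).toAddMonoidHom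

theorem redMod_apply (hpn : p ∣ n) (f : H →₀ ZMod n) (x : H) :
    redMod H hpn f x = ZMod.castHom hpn (ZMod p) (f x) := rfl

@[simp]
theorem redMod_single (hpn : p ∣ n) (x : H) (r : ZMod n) :
    redMod H hpn (Finsupp.single x r) = Finsupp.single x (ZMod.castHom hpn (ZMod p) r) :=
  Finsupp.mapRange_single (hf := map_zero _)

theorem redMod_surjective (hpn : p ∣ n) : Function.Surjective (redMod H hpn) :=
  Finsupp.mapRange_surjective _ (map_zero _) (ZMod.castHom_surjective hpn)

theorem redMod_translate [CommGroup H] (hpn : p ∣ n) (x : H) (f : H →₀ ZMod n) :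
    redMod H hpn (translate x f) = Finsupp.mapDomain (x * ·) (redMod H hpn f) := by
  rw [translate_eq_mapDomain]
  exact (Finsupp.mapDomain_mapRange _ _ _ (map_zero _) (map_add _)).symm

theorem exists_eq_smul_of_redMod_eq_zero [NeZero n] (hpn : p ∣ n) (f : H →₀ ZMod n)
    (hf : redMod H hpn f = 0) : ∃ d, f = p • d := by
  -- Divide the least nonnegative representatives by `p`; the division is exact because `f` vanishes
  -- mod `p`.
  refine ⟨f.mapRange (fun r => ((r.val / p : ℕ) : ZMod n)) (by simp), ?_⟩
  ext x
  have h1 : ((f x).val : ZMod p) = 0 := by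
    have := DFunLike.congr_fun hf x
    rwa [redMod_apply, ← ZMod.natCast_zmod_val (f x), map_natCast] at this
  have h2 : p ∣ (f x).val := (ZMod.natCast_eq_zero_iff _ _).1 h1
  simp only [Finsupp.smul_apply, Finsupp.mapRange_apply, nsmul_eq_mul]
  rw [← Nat.cast_mul, Nat.mul_div_cancel' h2, ZMod.natCast_zmod_val]

/-- A subgroup of a module over `ℤ/n` which is everything modulo each prime divisor of `n` is
everything. -/
theorem mem_of_forall_prime_dvd {E : Type*} [AddCommGroup E] (hn : n ≠ 0)
    (hE : ∀ d : E, n • d = 0) (I : AddSubgroup E)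
    (hI : ∀ p : ℕ, p.Prime → p ∣ n → ∀ d : E, ∃ f ∈ I, ∃ d', d = f + p • d') (d : E) : d ∈ I := by
  -- Prime steps compose multiplicatively, and at `m = n` the remainder `m • d'` vanishes.
  have key : ∀ m : ℕ, m ≠ 0 → m ∣ n → ∀ d : E, ∃ f ∈ I, ∃ d', d = f + m • d' := by
    intro m
    induction m using Nat.recOnMul with
    | zero => exact fun h => absurd rfl h
    | one => exact fun _ _ d => ⟨0, I.zero_mem, d, by simp⟩
    | prime p hp => exact fun _ h => hI p hp h
    | mul a b ha hb =>
      intro h0 h d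
      obtain ⟨f, hf, d', rfl⟩ := ha (left_ne_zero_of_mul h0) (dvd_of_mul_right_dvd h) d
      obtain ⟨f', hf', d'', rfl⟩ := hb (right_ne_zero_of_mul h0) (dvd_of_mul_left_dvd h) d'
      exact ⟨f + a • f', I.add_mem hf (I.nsmul_mem hf' a), d'', by
        rw [smul_add, smul_smul, add_assoc]⟩
  obtain ⟨f, hf, d', rfl⟩ := key n hn dvd_rfl d
  rwa [hE, add_zero]

/-- Modulo a prime, a semilinear automorphism of the base group is monomial. -/
theorem exists_redMod_eq [CommGroup H] [TwoUniqueProds H] [NeZero n] [Fact p.Prime] (hpn : p ∣ n)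
    (M : MulAut H) (ψ : (H →₀ ZMod n) ≃+ (H →₀ ZMod n))
    (hψ : ∀ y f, ψ (translate y f) = translate (M y) (ψ f)) :
    ∃ (a : H) (c : (ZMod p)ˣ), ∀ f, redMod H hpn (ψ f) =
      (c : ZMod p) • Finsupp.mapDomain (fun y => a * M y) (redMod H hpn f) := by
  -- By semilinearity `ψ` is determined by its value at the basis vector of the identity: mod `p` it
  -- is `M` followed by multiplication by `u`.
  let u : MonoidAlgebra (ZMod p) H := .ofCoeff (redMod H hpn (ψ (Finsupp.single 1 1)))
  have hmul : ∀ f, redMod H hpn (ψ f) =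
      (u * MonoidAlgebra.ofCoeff (Finsupp.mapDomain M (redMod H hpn f))).coeff := by
    intro f
    induction f using Finsupp.induction_linear with
    | zero => simp
    | add f g hf hg =>
      rw [map_add, map_add, map_add, Finsupp.mapDomain_add, MonoidAlgebra.ofCoeff_add, mul_add,
        MonoidAlgebra.coeff_add, hf, hg]
    | single y r =>
      have h1 : (Finsupp.single y r : H →₀ ZMod n) =
          r.val • translate y (Finsupp.single 1 1) := by
        simp
      have h2 : (Finsupp.single y (ZMod.castHom hpn (ZMod p) r) : H →₀ ZMod p) =
          r.val • Finsupp.single y 1 := by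
        rw [Finsupp.smul_single, nsmul_one, ← map_natCast (ZMod.castHom hpn (ZMod p)),
          ZMod.natCast_zmod_val]
      rw [redMod_single, h2, h1, map_nsmul, map_nsmul, hψ, redMod_translate,
        Finsupp.mapDomain_smul, Finsupp.mapDomain_single, MonoidAlgebra.ofCoeff_smul,
        mul_smul_comm, MonoidAlgebra.coeff_smul, MonoidAlgebra.ofCoeff_single, mul_comm,
        coeff_single_mul_ofCoeff, one_smul]
  obtain ⟨a, c, hac⟩ : ∃ (a : H) (c : (ZMod p)ˣ), u = MonoidAlgebra.single a (c : ZMod p) := by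
    -- The inverse of `u` comes from applying the product formula to the preimage of that basis
    -- vector under `ψ`.
    refine exists_eq_single_of_mul_eq_one
      (v := .ofCoeff (Finsupp.mapDomain M (redMod H hpn (ψ.symm (Finsupp.single 1 1))))) ?_
    apply MonoidAlgebra.coeff_injective
    rw [← hmul, AddEquiv.apply_symm_apply, redMod_single, map_one]
    rfl
  refine ⟨a, c, fun f => ?_⟩
  rw [hmul, hac, coeff_single_mul_ofCoeff, ← Finsupp.mapDomain_comp]
  rfl

end Reduction

/-! ### Monomial operators and functions on orbits -/

section Monomial

/-- A monomial operator `Q` on a free module for which every basis vector is periodic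
with `1 - c ^ s` invertible has `1 - Q` surjective. -/
theorem exists_sub_smul_mapDomain_eq {K X : Type*} [CommRing K] (P : X → X) (c : K)
    (hP : ∀ y, ∃ s : ℕ, P^[s] y = y ∧ IsUnit (1 - c ^ s)) (d : X →₀ K) :
    ∃ f, f - c • Finsupp.mapDomain P f = d := by
  let Q : Module.End K (X →₀ K) := c • Finsupp.lmapDomain K K P
  have hQ : ∀ (s : ℕ) (y : X) (r : K),
      (Q ^ s) (Finsupp.single y r) = Finsupp.single (P^[s] y) (c ^ s * r) := by
    intro s
    induction s with
    | zero => simp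
    | succ s ih =>
      intro y r
      rw [pow_succ, Module.End.mul_apply]
      have : Q (Finsupp.single y r) = Finsupp.single (P y) (c * r) := by
        simp [Q, Finsupp.mapDomain_single]
      rw [this, ih, Function.iterate_succ_apply, pow_succ, mul_assoc]
  let T : Module.End K (X →₀ K) := 1 - Q
  suffices h : d ∈ LinearMap.range T from h
  induction d using Finsupp.induction_linear with
  | zero => exact Submodule.zero_mem _
  | add f g hf hg => exact Submodule.add_mem _ hf hg
  | single y r =>
    obtain ⟨s, hs, u, hu⟩ := hP y
    -- On the basis vector at `y`, `1 - Q ^ s` is the scalar `1 - c ^ s`, which is a unit.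
    have hgeom : T * ∑ i ∈ Finset.range s, Q ^ i = 1 - Q ^ s := mul_neg_geom_sum Q s
    refine ⟨(∑ i ∈ Finset.range s, Q ^ i) (Finsupp.single y (↑u⁻¹ * r)), ?_⟩
    rw [← Module.End.mul_apply, hgeom, LinearMap.sub_apply, hQ, hs,
      Module.End.one_apply, ← Finsupp.single_sub, ← one_sub_mul, ← hu, Units.mul_inv_cancel_left]

/-- A twisted-invariant function supported on the orbit of `y`. -/
theorem exists_orbit_function {K H : Type*} [Field K] [Group H] (M : MulAut H) (y : H) (c : Kˣ)
    (hy : ∀ s : ℕ, 0 < s → (M ^ s) y = y → c ^ s = 1) :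
    ∃ w : H → K, w y = 1 ∧ (∀ z, (c : K) * w (M z) = w z) ∧
      ∀ z, (∀ i : ℤ, (M ^ i) y ≠ z) → w z = 0 := by
  classical
  have hz : ∀ i : ℤ, (M ^ i) y = y → c ^ i = 1 := by
    intro i hi
    rcases Int.eq_nat_or_neg i with ⟨s, rfl | rfl⟩
    · rcases Nat.eq_zero_or_pos s with rfl | hs
      · simp
      · rw [zpow_natCast] at hi ⊢
        exact hy s hs hi
    · rcases Nat.eq_zero_or_pos s with rfl | hs
      · simp
      · rw [zpow_neg, zpow_natCast, MulAut.inv_apply, MulEquiv.symm_apply_eq] at hi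
        rw [zpow_neg, zpow_natCast, hy s hs hi.symm, inv_one]
  have hwd : ∀ i j : ℤ, (M ^ i) y = (M ^ j) y → c ^ (-i) = c ^ (-j) := by
    intro i j hij
    have : (M ^ (-j + i)) y = y := by
      rw [zpow_add, MulAut.mul_apply, hij, ← MulAut.mul_apply, ← zpow_add]
      simp
    have h1 := hz _ this
    rw [zpow_add, mul_eq_one_iff_eq_inv, ← zpow_neg] at h1
    exact h1.symm
  -- The value at `(M ^ i) y` is `c ^ (-i)`, independent of `i` because every period `s` of `y` has
  -- `c ^ s = 1`. An infinite orbit imposes no condition.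
  let w : H → K := fun z =>
    if h : ∃ i : ℤ, (M ^ i) y = z then ((c ^ (-h.choose) : Kˣ) : K) else 0
  have hw : ∀ i : ℤ, w ((M ^ i) y) = ((c ^ (-i) : Kˣ) : K) := by
    intro i
    have h : ∃ j : ℤ, (M ^ j) y = (M ^ i) y := ⟨i, rfl⟩
    simp only [w, dif_pos h]
    rw [hwd _ _ h.choose_spec]
  have hw0 : ∀ z, (∀ i : ℤ, (M ^ i) y ≠ z) → w z = 0 := fun z hz =>
    dif_neg fun ⟨i, hi⟩ => hz i hi
  refine ⟨w, by simpa using hw 0, fun z => ?_, hw0⟩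
  by_cases h : ∃ i : ℤ, (M ^ i) y = z
  · obtain ⟨i, rfl⟩ := h
    have : M ((M ^ i) y) = (M ^ (1 + i)) y := by rw [zpow_add, zpow_one, MulAut.mul_apply]
    rw [this, hw, hw, ← Units.val_mul, ← zpow_one_add]
    simp
  · push Not at h
    rw [hw0 z h, hw0, mul_zero]
    intro i hi
    refine h (-1 + i) ?_
    rw [zpow_add, MulAut.mul_apply, hi, zpow_neg_one, MulAut.inv_apply_self]

end Monomial

/-! ### Finite cokernel forces surjectivity -/

section Finiteness

variable {H : Type*} [CommGroup H] {n p : ℕ} {M : MulAut H}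
  {ψ : (H →₀ ZMod n) ≃+ (H →₀ ZMod n)}
  {φ : RestrictedWreath (ZMod n) H ≃* RestrictedWreath (ZMod n) H}

/-- The reduction modulo `p` of `ψ` is the monomial operator with translation part `a`,
linear part `M` and coefficient `c`. -/
def IsMonomialMod (hpn : p ∣ n) (M : MulAut H) (ψ : (H →₀ ZMod n) ≃+ (H →₀ ZMod n)) (a : H)
    (c : (ZMod p)ˣ) : Prop :=
  ∀ f, redMod H hpn (ψ f) =
    (c : ZMod p) • Finsupp.mapDomain (fun y => a * M y) (redMod H hpn f)

theorem IsMonomialMod.redMod_translate {hpn : p ∣ n} {a : H} {c : (ZMod p)ˣ}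
    (h : IsMonomialMod hpn M ψ a c) (x : H) (f : H →₀ ZMod n) :
    redMod H hpn (translate x (ψ f)) =
      (c : ZMod p) • Finsupp.mapDomain (fun y => x * (a * M y)) (redMod H hpn f) := by
  rw [TwistedBurnside.redMod_translate, h, Finsupp.mapDomain_smul, ← Finsupp.mapDomain_comp]
  rfl

/-- If the Reidemeister number is finite, every nontrivial orbit of `M` is finite, with a period
`s` such that `c ^ s ≠ 1`. -/
theorem IsDecomposed.exists_period [IsMulTorsionFree H] [Fact p.Prime] {hpn : p ∣ n}
    (hφ : IsDecomposed φ M ψ) (hM : ∀ z, M z = z → z = 1) (hR : reidemeisterNumber φ ≠ ⊤)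
    (horb : ∀ y : H, y ≠ 1 → ∀ (i : ℤ) (j l : ℕ), (M ^ i) (y ^ j) = y ^ l → j = l)
    {a : H} {c : (ZMod p)ˣ} (hψ : IsMonomialMod hpn M ψ a c) (y : H) (hy : y ≠ 1) :
    ∃ s : ℕ, 0 < s ∧ (M ^ s) y = y ∧ c ^ s ≠ 1 := by
  by_contra! hbad
  -- Taking `x = a⁻¹` cancels the translation part, leaving `f ↦ c • M f` mod `p`. The shift `i + 1`
  -- keeps the exponents nonzero, so a period of `y ^ (i + 1)` is one of `y`.
  obtain ⟨i, j, hij, f, hf⟩ := hφ.exists_ne_sub_eq hM hR a⁻¹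
    fun i => Finsupp.single (y ^ (i + 1)) 1
  obtain ⟨w, hw1, hwM, hw0⟩ := exists_orbit_function M (y ^ (i + 1)) c fun s hs h => by
    refine hbad s hs ?_
    rw [map_pow] at h
    exact pow_left_injective i.succ_ne_zero h
  have hj : w (y ^ (j + 1)) = 0 := hw0 _ fun t ht => hij (by simpa using horb y hy t _ _ ht)
  -- Pairing with `w` kills the left side by invariance, but gives `1 - 0` on the right, since the
  -- two powers lie in different orbits.
  have h := congrArg (fun d => Finsupp.linearCombination (ZMod p) w (redMod H hpn d)) hf
  have hinv : (fun y => a⁻¹ * (a * M y)) = M := funext fun y => inv_mul_cancel_left _ _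
  simp only [map_sub, hψ.redMod_translate, hinv, redMod_single, map_one, map_smul,
    Finsupp.linearCombination_mapDomain, Finsupp.linearCombination_single, hw1, hj] at h
  have hcomp : (c : ZMod p) • Finsupp.linearCombination (ZMod p) (w ∘ M) (redMod H hpn f) =
      Finsupp.linearCombination (ZMod p) w (redMod H hpn f) := by
    rw [Finsupp.linearCombination_apply, Finsupp.linearCombination_apply, Finsupp.smul_sum]
    refine Finsupp.sum_congr fun z _ => ?_
    rw [← hwM z, Function.comp_apply]
    simp only [smul_eq_mul]
    ring
  rw [hcomp] at h
  simp at h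

/-- If the Reidemeister number is finite, every `1 - t^x ψ` is surjective modulo `p`. -/
theorem IsMonomialMod.exists_redMod_eq [IsMulTorsionFree H] [Fact p.Prime] [Nontrivial H]
    [Finite (H ⧸ coboundaries M)] {hpn : p ∣ n} {a : H} {c : (ZMod p)ˣ}
    (hψ : IsMonomialMod hpn M ψ a c)
    (hper : ∀ y : H, y ≠ 1 → ∃ s : ℕ, 0 < s ∧ (M ^ s) y = y ∧ c ^ s ≠ 1)
    (x : H) (d : H →₀ ZMod n) :
    ∃ f, redMod H hpn (f - translate x (ψ f)) = redMod H hpn d := by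
  -- The affine map `y ↦ x a M y` need not have a fixed point in `H`, but after `e`-th powers it
  -- does, namely `z`. The injective map `Θ y = y ^ e / z` then carries it to `M`, so its periods
  -- are periods of `M`.
  obtain ⟨e, he, z, hz⟩ : ∃ e : ℕ, e ≠ 0 ∧ ∃ z, z / M z = (x * a) ^ e := by
    refine ⟨Nat.card (H ⧸ coboundaries M), Nat.card_pos.ne', mem_coboundaries.1 ?_⟩
    rw [← QuotientGroup.eq_one_iff, QuotientGroup.mk_pow, pow_card_eq_one']
  obtain ⟨g, hg⟩ := exists_sub_smul_mapDomain_eq (fun y => x * (a * M y)) (c : ZMod p) (fun y => by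
    set P : H → H := fun y => x * (a * M y) with hP
    let Θ : H → H := fun y => y ^ e / z
    have hΘinj : Function.Injective Θ := fun y y' h =>
      pow_left_injective he (div_left_injective h)
    have hΘ : ∀ y, Θ (P y) = M (Θ y) := by
      intro y
      simp only [Θ, P, map_div, map_pow]
      rw [← mul_assoc, mul_pow, ← hz]
      simp [div_eq_mul_inv, mul_comm, mul_left_comm]
    have hiter : ∀ (s : ℕ) (y), Θ (P^[s] y) = (M ^ s) (Θ y) := by
      intro s
      induction s with
      | zero => simp
      | succ s ih =>
        intro y
        rw [Function.iterate_succ_apply, ih, hΘ, pow_succ, MulAut.mul_apply]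
    -- Here `y` is itself a fixed point, so `c ≠ 1` is needed; it follows from the period condition
    -- at any nontrivial element.
    by_cases h1 : Θ y = 1
    · refine ⟨1, hΘinj ?_, ?_⟩
      · rw [hiter, h1, map_one]
      · obtain ⟨y', hy'⟩ := exists_ne (1 : H)
        obtain ⟨s, -, -, hs⟩ := hper y' hy'
        rw [pow_one]
        refine (sub_ne_zero.2 fun hc => ?_).isUnit
        exact hs (by rw [Units.val_eq_one.1 hc.symm, one_pow])
    · obtain ⟨s, -, hs, hc⟩ := hper _ h1
      refine ⟨s, hΘinj ((hiter s y).trans hs), (sub_ne_zero.2 fun h => hc (Units.ext ?_)).isUnit⟩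
      simpa using h.symm) (redMod H hpn d)
  obtain ⟨f, rfl⟩ := redMod_surjective hpn g
  exact ⟨f, by rw [map_sub, hψ.redMod_translate, hg]⟩

/-- A finite Reidemeister number forces every `1 - t^x ψ` to be surjective. -/
theorem IsDecomposed.exists_sub_translate_eq [IsMulTorsionFree H] [TwoUniqueProds H]
    [Nontrivial H] [NeZero n] (hφ : IsDecomposed φ M ψ) (hM : ∀ z, M z = z → z = 1)
    (hR : reidemeisterNumber φ ≠ ⊤)
    (horb : ∀ y : H, y ≠ 1 → ∀ (i : ℤ) (j l : ℕ), (M ^ i) (y ^ j) = y ^ l → j = l)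
    (x : H) (d : H →₀ ZMod n) : ∃ f, f - translate x (ψ f) = d := by
  have := hφ.finite_coinvariants hR
  let T : (H →₀ ZMod n) →+ (H →₀ ZMod n) :=
    AddMonoidHom.id _ - (translate x).toAddMonoidHom.comp ψ.toAddMonoidHom
  refine mem_of_forall_prime_dvd (NeZero.ne n) (fun d => ?_) T.range
    (fun p hp hpn d => ?_) d
  · ext
    simp
  · have : Fact p.Prime := ⟨hp⟩
    obtain ⟨a, c, hac⟩ := TwistedBurnside.exists_redMod_eq hpn M ψ hφ.map_translate
    have hac : IsMonomialMod hpn M ψ a c := hac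
    obtain ⟨f, hf⟩ := hac.exists_redMod_eq (hφ.exists_period hM hR horb hac) x d
    obtain ⟨d', hd'⟩ := exists_eq_smul_of_redMod_eq_zero hpn (d - T f) (by
      rw [map_sub, sub_eq_zero]
      exact hf.symm)
    exact ⟨T f, ⟨f, rfl⟩, d', by rw [← hd', add_sub_cancel]⟩

end Finiteness

/-! ### Automorphisms of ℤ^k -/

section Lattice

open Matrix

/-- Intermediate value theorem; the limit at `-∞` is obtained by substituting `-X`. -/
theorem exists_isRoot_of_monic_of_odd_natDegree (q : Polynomial ℝ) (hq : q.Monic)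
    (hodd : Odd q.natDegree) : ∃ t, q.IsRoot t := by
  have hdeg : 0 < q.natDegree := hodd.pos
  have htop : Filter.Tendsto (fun x => q.eval x) Filter.atTop Filter.atTop :=
    q.tendsto_atTop_of_leadingCoeff_nonneg (Polynomial.natDegree_pos_iff_degree_pos.1 hdeg)
      (by simp [hq.leadingCoeff])
  have hbot : Filter.Tendsto (fun x => q.eval x) Filter.atBot Filter.atBot := by
    have hd : (q.comp (-Polynomial.X)).natDegree = q.natDegree := by
      simp [Polynomial.natDegree_comp]
    have h : Filter.Tendsto (fun x => (q.comp (-Polynomial.X)).eval x) Filter.atTop Filter.atBot := by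
      refine Polynomial.tendsto_atBot_of_leadingCoeff_nonpos _
        (Polynomial.natDegree_pos_iff_degree_pos.1 (hd ▸ hdeg)) ?_
      rw [Polynomial.leadingCoeff_comp (by simp), hq.leadingCoeff]
      simp [hodd.neg_one_pow]
    refine (h.comp Filter.tendsto_neg_atBot_atTop).congr fun x => ?_
    simp
  exact q.continuous.surjective htop hbot 0

/-- An integral matrix of odd size and odd order has a nonzero fixed vector. -/
theorem exists_mulVec_eq_self_of_odd {k S : ℕ} (hk : Odd k) (hS : Odd S)
    (A : Matrix (Fin k) (Fin k) ℤ) (hA : A ^ S = 1) : ∃ v ≠ 0, A *ᵥ v = v := by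
  let B : Matrix (Fin k) (Fin k) ℝ := A.map (Int.castRingHom ℝ)
  have hB : B ^ S = 1 := by
    have := congrArg (Int.castRingHom ℝ).mapMatrix hA
    rwa [map_pow, map_one] at this
  obtain ⟨t, ht⟩ := exists_isRoot_of_monic_of_odd_natDegree B.charpoly B.charpoly_monic
    (by rwa [Matrix.charpoly_natDegree_eq_dim, Fintype.card_fin])
  have hdet : (Matrix.scalar (Fin k) t - B).det = 0 := by
    rw [← Matrix.eval_charpoly]
    exact ht
  obtain ⟨v, hv, hvt⟩ := Matrix.exists_mulVec_eq_zero_iff.2 hdet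
  have hBv : B *ᵥ v = t • v := by
    rw [Matrix.sub_mulVec, sub_eq_zero] at hvt
    rw [← hvt]
    ext i
    simp
  have hpow : ∀ s : ℕ, (B ^ s) *ᵥ v = t ^ s • v := by
    intro s
    induction s with
    | zero => simp
    | succ s ih => rw [pow_succ, ← Matrix.mulVec_mulVec, hBv, Matrix.mulVec_smul, ih, smul_smul,
        pow_succ']
  -- The real eigenvalue satisfies `t ^ S = 1`, and odd powers are injective on ℝ.
  have ht1 : t = 1 := by
    have h := hpow S
    rw [hB, Matrix.one_mulVec] at h
    have h1 : t ^ S = 1 ^ S := by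
      rw [one_pow]
      refine smul_left_injective ℝ hv ?_
      simp only [← h, one_smul]
    exact hS.strictMono_pow.injective h1
  -- Singularity of `1 - A` descends to ℤ through the determinant, giving an integral fixed vector.
  have hdetA : (1 - A).det = 0 := by
    rw [ht1, map_one] at hdet
    have h : (Int.castRingHom ℝ) (1 - A).det = 0 := by
      rw [RingHom.map_det, map_sub, map_one]
      exact hdet
    exact (Int.cast_eq_zero (α := ℝ)).1 h
  obtain ⟨u, hu, hu0⟩ := Matrix.exists_mulVec_eq_zero_iff.2 hdetA
  refine ⟨u, hu, ?_⟩
  rw [Matrix.sub_mulVec, Matrix.one_mulVec, sub_eq_zero] at hu0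
  exact hu0.symm

variable {k : ℕ}

/-- The matrix of an automorphism of the lattice `ℤ^k`. -/
def latticeMatrix (M : MulAut (Multiplicative (Fin k → ℤ))) : Matrix (Fin k) (Fin k) ℤ :=
  LinearMap.toMatrix' (AddMonoidHom.toIntLinearMap (MonoidHom.toAdditive M.toMonoidHom) :
    (Fin k → ℤ) →ₗ[ℤ] (Fin k → ℤ))

theorem latticeMatrix_mulVec (M : MulAut (Multiplicative (Fin k → ℤ))) (v : Fin k → ℤ) :
    latticeMatrix M *ᵥ v = Multiplicative.toAdd (M (Multiplicative.ofAdd v)) := by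
  rw [latticeMatrix, LinearMap.toMatrix'_mulVec]
  rfl

theorem latticeMatrix_pow_mulVec (M : MulAut (Multiplicative (Fin k → ℤ))) (s : ℕ)
    (v : Fin k → ℤ) :
    (latticeMatrix M ^ s) *ᵥ v = Multiplicative.toAdd ((M ^ s) (Multiplicative.ofAdd v)) := by
  induction s generalizing v with
  | zero => simp
  | succ s ih => rw [pow_succ, ← Matrix.mulVec_mulVec, latticeMatrix_mulVec, ih, pow_succ]; rfl

/-- An automorphism of `ℤ^k` with finitely many coinvariants has no nontrivial fixed points. -/
theorem eq_one_of_fixed (M : MulAut (Multiplicative (Fin k → ℤ)))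
    [Finite (Multiplicative (Fin k → ℤ) ⧸ coboundaries M)] (z : Multiplicative (Fin k → ℤ))
    (hz : M z = z) : z = 1 := by
  set e := Nat.card (Multiplicative (Fin k → ℤ) ⧸ coboundaries M) with he
  have he0 : (e : ℤ) ≠ 0 := Nat.cast_ne_zero.2 Nat.card_pos.ne'
  -- The order `e` of the coinvariants kills them, so `1 - M` has a right inverse up to the factor
  -- `e` and its determinant is nonzero.
  have h : ∀ i : Fin k, ∃ b : Fin k → ℤ,
      (1 - latticeMatrix M) *ᵥ b = (e : ℤ) • Pi.single i 1 := by
    intro i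
    obtain ⟨b, hb⟩ : ∃ b, b / M b = Multiplicative.ofAdd (Pi.single i (1 : ℤ)) ^ e := by
      refine mem_coboundaries.1 ?_
      rw [← QuotientGroup.eq_one_iff, QuotientGroup.mk_pow, pow_card_eq_one']
    refine ⟨Multiplicative.toAdd b, ?_⟩
    rw [Matrix.sub_mulVec, Matrix.one_mulVec, latticeMatrix_mulVec, natCast_zsmul]
    exact congrArg Multiplicative.toAdd hb
  choose b hb using h
  have hmul : (1 - latticeMatrix M) * (Matrix.of b)ᵀ = (e : ℤ) • (1 : Matrix (Fin k) (Fin k) ℤ) := by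
    ext i j
    have := congrFun (hb j) i
    simp only [Matrix.mulVec, Matrix.mul_apply, dotProduct, Pi.smul_apply, Matrix.smul_apply,
      Matrix.transpose_apply, Matrix.of_apply, Matrix.one_apply, Pi.single_apply] at this ⊢
    exact this
  have hdet : (1 - latticeMatrix M).det ≠ 0 := by
    intro h0
    have := congrArg Matrix.det hmul
    rw [Matrix.det_mul, h0, zero_mul, Matrix.det_smul, Matrix.det_one, mul_one] at this
    exact pow_ne_zero _ he0 this.symm
  refine Multiplicative.toAdd.injective (Matrix.eq_zero_of_mulVec_eq_zero hdet ?_)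
  rw [Matrix.sub_mulVec, Matrix.one_mulVec, latticeMatrix_mulVec, ofAdd_toAdd, hz, sub_self]

/-- An integral matrix sends `g • u` to a multiple of `g`. Used for `N` and `N⁻¹`, this makes the
gcd of the coordinates an invariant, which separates the orbits of the multiples of a vector. -/
theorem gcd_dvd_gcd_apply (N : MulAut (Multiplicative (Fin k → ℤ)))
    (v : Multiplicative (Fin k → ℤ)) :
    Finset.univ.gcd (Multiplicative.toAdd v) ∣ Finset.univ.gcd (Multiplicative.toAdd (N v)) := by
  set g := Finset.univ.gcd (Multiplicative.toAdd v) with hg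
  have hdvd : ∀ i, ∃ u, Multiplicative.toAdd v i = g * u := fun i =>
    Finset.gcd_dvd (Finset.mem_univ i)
  choose u hu using hdvd
  have hv : Multiplicative.toAdd v = g • u := funext hu
  have hNv : Multiplicative.toAdd (N v) = g • (latticeMatrix N *ᵥ u) := by
    rw [← Matrix.mulVec_smul, ← hv, latticeMatrix_mulVec, ofAdd_toAdd]
  refine Finset.dvd_gcd fun i _ => ?_
  rw [hNv]
  exact Dvd.intro _ rfl

theorem gcd_apply (N : MulAut (Multiplicative (Fin k → ℤ))) (v : Multiplicative (Fin k → ℤ)) :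
    Finset.univ.gcd (Multiplicative.toAdd (N v)) = Finset.univ.gcd (Multiplicative.toAdd v) := by
  refine dvd_antisymm_of_normalize_eq Finset.normalize_gcd Finset.normalize_gcd ?_
    (gcd_dvd_gcd_apply N v)
  simpa using gcd_dvd_gcd_apply N⁻¹ (N v)

/-- Distinct powers of a nontrivial vector lie in distinct orbits of the automorphism group. -/
theorem eq_of_apply_pow_eq_pow (N : MulAut (Multiplicative (Fin k → ℤ)))
    (y : Multiplicative (Fin k → ℤ)) (hy : y ≠ 1) (j l : ℕ) (h : N (y ^ j) = y ^ l) : j = l := by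
  have hpow : ∀ j : ℕ, Finset.univ.gcd (Multiplicative.toAdd (y ^ j)) =
      (j : ℤ) * Finset.univ.gcd (Multiplicative.toAdd y) := by
    intro j
    have : Multiplicative.toAdd (y ^ j) = fun i => (j : ℤ) * Multiplicative.toAdd y i := by
      rw [toAdd_pow]
      ext i
      simp
    rw [this, Finset.gcd_mul_left, Int.normalize_coe_nat]
  have hne : Finset.univ.gcd (Multiplicative.toAdd y) ≠ 0 := by
    intro h0
    refine hy (Multiplicative.toAdd.injective (funext fun i => ?_))
    exact Finset.gcd_eq_zero_iff.1 h0 i (Finset.mem_univ i)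
  have := gcd_apply N (y ^ j)
  rw [h, hpow, hpow] at this
  exact_mod_cast (mul_right_cancel₀ hne this).symm

/-- A subgroup of `ℤ^k` containing all `e`-th powers has finite index. -/
theorem finite_quotient_of_pow_mem (N : Subgroup (Multiplicative (Fin k → ℤ))) {e : ℕ}
    (he : e ≠ 0) (h : ∀ z, z ^ e ∈ N) : Finite (Multiplicative (Fin k → ℤ) ⧸ N) := by
  have : AddGroup.FG (Fin k → ℤ) := Module.Finite.iff_addGroup_fg.1 inferInstance
  have : Group.FG (Multiplicative (Fin k → ℤ)) := inferInstance
  have : Group.FG (Multiplicative (Fin k → ℤ) ⧸ N) := QuotientGroup.fg N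
  refine CommGroup.finite_of_fg_isMulTorsion _ fun g => ?_
  obtain ⟨z, rfl⟩ := QuotientGroup.mk_surjective g
  refine isOfFinOrder_iff_pow_eq_one.2 ⟨e, Nat.pos_of_ne_zero he, ?_⟩
  rw [← QuotientGroup.mk_pow, QuotientGroup.eq_one_iff]
  exact h z

end Lattice

/-! ### Burnside–Frobenius equality and restrictions on `n` and `k` -/

section Necessity

variable {n k : ℕ}

theorem exists_ne_one (hk : 0 < k) : ∃ y : Multiplicative (Fin k → ℤ), y ≠ 1 := by
  have : NeZero k := ⟨hk.ne'⟩
  exact exists_ne 1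

theorem exists_isDecomposed_lamplighter (hn : 0 < n) (φ : Lamplighter n k ≃* Lamplighter n k) :
    ∃ M ψ, IsDecomposed φ M ψ :=
  exists_isDecomposed hn.ne' (fun a : ZMod n => by simp) φ

/-- The finite-dimensional twisted Burnside–Frobenius theorem for lamplighter groups. -/
theorem tbftf_lamplighter (hk : 0 < k) (hn : 0 < n) : TBFTf (Lamplighter n k) := by
  intro φ hR
  have : NeZero n := ⟨hn.ne'⟩
  have : NeZero k := ⟨hk.ne'⟩
  obtain ⟨M, ψ, hφ⟩ := exists_isDecomposed_lamplighter hn φ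
  have := hφ.finite_coinvariants hR
  have hsurj := hφ.exists_sub_translate_eq (eq_one_of_fixed M) hR
    fun y hy i => eq_of_apply_pow_eq_pow (M ^ i) y hy
  rw [hφ.reidemeisterNumber_eq hsurj, hφ.encard_fixedPoints_eq hsurj]

/-- A finite Reidemeister number gives, for each prime divisor `p` of `n`, a unit `c` modulo `p`
and, for each nontrivial vector, a period `s` with `c ^ s ≠ 1`. -/
theorem exists_unit_period (hn : 0 < n) {φ : Lamplighter n k ≃* Lamplighter n k}
    (hR : reidemeisterNumber φ ≠ ⊤) {p : ℕ} [Fact p.Prime] (hpn : p ∣ n)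
    {M : MulAut (Multiplicative (Fin k → ℤ))} {ψ} (hφ : IsDecomposed φ M ψ) :
    ∃ c : (ZMod p)ˣ, ∀ y, y ≠ 1 → ∃ s : ℕ, 0 < s ∧ (M ^ s) y = y ∧ c ^ s ≠ 1 := by
  have : NeZero n := ⟨hn.ne'⟩
  have := hφ.finite_coinvariants hR
  obtain ⟨a, c, hac⟩ := exists_redMod_eq hpn M ψ hφ.map_translate
  exact ⟨c, hφ.exists_period (eq_one_of_fixed M) hR
    (fun y hy i => eq_of_apply_pow_eq_pow (M ^ i) y hy) (hpn := hpn) (a := a) hac⟩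

/-- The only unit mod 2 is 1, so no period satisfies `c ^ s ≠ 1`. -/
theorem not_two_dvd_of_finite (hk : 0 < k) (hn : 0 < n) {φ : Lamplighter n k ≃* Lamplighter n k}
    (hR : reidemeisterNumber φ ≠ ⊤) : ¬ 2 ∣ n := by
  intro h2
  obtain ⟨M, ψ, hφ⟩ := exists_isDecomposed_lamplighter hn φ
  obtain ⟨c, hc⟩ := exists_unit_period hn hR h2 hφ
  obtain ⟨y, hy⟩ := exists_ne_one hk
  obtain ⟨s, -, -, hs⟩ := hc y hy
  exact hs (by rw [Subsingleton.elim c 1, one_pow])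

/-- Units mod 3 square to 1, so `c ^ s ≠ 1` makes `s` odd. The product of such periods over the
standard basis is an odd exponent killing `M`; for odd `k` this yields a nonzero fixed vector, which
finite coinvariants exclude. -/
theorem even_of_finite_of_three_dvd (hn : 0 < n) {φ : Lamplighter n k ≃* Lamplighter n k}
    (hR : reidemeisterNumber φ ≠ ⊤) (h3 : 3 ∣ n) : Even k := by
  by_contra hk
  rw [Nat.not_even_iff_odd] at hk
  obtain ⟨M, ψ, hφ⟩ := exists_isDecomposed_lamplighter hn φ
  have := hφ.finite_coinvariants hR
  have : Fact (Nat.Prime 3) := ⟨Nat.prime_three⟩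
  obtain ⟨c, hc⟩ := exists_unit_period hn hR h3 hφ
  have hodd : ∀ i : Fin k, ∃ s : ℕ, Odd s ∧
      (M ^ s) (Multiplicative.ofAdd (Pi.single i 1)) = Multiplicative.ofAdd (Pi.single i 1) := by
    intro i
    obtain ⟨s, -, hs, hcs⟩ := hc (Multiplicative.ofAdd (Pi.single i 1)) fun h => by
      have := congrFun (congrArg Multiplicative.toAdd h) i
      simp at this
    refine ⟨s, Nat.not_even_iff_odd.1 fun he => hcs ?_, hs⟩
    obtain ⟨r, rfl⟩ := he
    have hsq : c ^ 2 = 1 := ZMod.units_pow_card_sub_one_eq_one 3 c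
    rw [← two_mul, pow_mul, hsq, one_pow]
  choose s hs hMs using hodd
  have hS : Odd (∏ i, s i) := by
    refine Finset.prod_induction _ Odd (fun _ _ => Odd.mul) odd_one fun i _ => hs i
  have hA : latticeMatrix M ^ (∏ i, s i) = 1 := by
    refine Matrix.ext_of_mulVec_single fun i => ?_
    rw [latticeMatrix_pow_mulVec, Matrix.one_mulVec]
    obtain ⟨r, hr⟩ := Finset.dvd_prod_of_mem s (Finset.mem_univ i)
    rw [hr, pow_mul]
    have hfix : ∀ r : ℕ, ((M ^ s i) ^ r) (Multiplicative.ofAdd (Pi.single i (1 : ℤ))) =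
        Multiplicative.ofAdd (Pi.single i 1) := by
      intro r
      induction r with
      | zero => simp
      | succ r ih => rw [pow_succ, MulAut.mul_apply, hMs, ih]
    rw [hfix, toAdd_ofAdd]
  obtain ⟨v, hv, hfix⟩ := exists_mulVec_eq_self_of_odd hk hS _ hA
  refine hv (Multiplicative.ofAdd.injective (eq_one_of_fixed M (Multiplicative.ofAdd v) ?_))
  rw [latticeMatrix_mulVec] at hfix
  exact Multiplicative.toAdd.injective hfix

end Necessity

/-! ### Automorphisms with finite Reidemeister number -/

section Existence

variable {H : Type*} [CommGroup H] {n : ℕ}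

/-- The monomial automorphism `f ↦ c • M f` of the base group. -/
def monomialBase (M : MulAut H) (c : (ZMod n)ˣ) : (H →₀ ZMod n) ≃+ (H →₀ ZMod n) :=
  (Finsupp.domCongr M.toEquiv).trans (DistribMulAction.toAddEquiv (H →₀ ZMod n) c)

theorem monomialBase_apply (M : MulAut H) (c : (ZMod n)ˣ) (f : H →₀ ZMod n) :
    monomialBase M c f = (c : ZMod n) • Finsupp.mapDomain M f := by
  change c • Finsupp.equivMapDomain M.toEquiv f = _
  rw [Finsupp.equivMapDomain_eq_mapDomain]
  rfl

theorem monomialBase_translate (M : MulAut H) (c : (ZMod n)ˣ) (x : H) (f : H →₀ ZMod n) :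
    monomialBase M c (translate x f) = translate (M x) (monomialBase M c f) := by
  simp only [monomialBase_apply, translate_eq_mapDomain, Finsupp.mapDomain_smul,
    ← Finsupp.mapDomain_comp]
  congr 2
  ext y
  simp

/-- The monomial automorphism of a wreath product given by an automorphism of `H` and a unit. -/
def monomialAut (M : MulAut H) (c : (ZMod n)ˣ) :
    RestrictedWreath (ZMod n) H ≃* RestrictedWreath (ZMod n) H :=
  SemidirectProduct.congr (AddEquiv.toMultiplicative (monomialBase M c)) M fun x =>
    MulEquiv.ext fun f => congrArg Multiplicative.ofAdd
      (monomialBase_translate M c x (Multiplicative.toAdd f))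

theorem isDecomposed_monomialAut (M : MulAut H) (c : (ZMod n)ˣ) :
    IsDecomposed (monomialAut M c) M (monomialBase M c) where
  map_right _ := rfl
  map_lamp _ := SemidirectProduct.ext rfl (map_one M)

/-- A common period `s` of all the affine maps `y ↦ x * M y` lets the geometric-sum argument run
directly over ℤ/n. -/
theorem reidemeisterNumber_monomialAut (M : MulAut H) (c : (ZMod n)ˣ) (s : ℕ)
    (hM : ∀ x y, (fun y => x * M y)^[s] y = y) (hc : IsUnit (1 - (c : ZMod n) ^ s)) :
    reidemeisterNumber (monomialAut M c) = ENat.card (H ⧸ coboundaries M) := by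
  refine (isDecomposed_monomialAut M c).reidemeisterNumber_eq fun x d => ?_
  obtain ⟨f, hf⟩ := exists_sub_smul_mapDomain_eq (fun y => x * M y) (c : ZMod n)
    (fun y => ⟨s, hM x y, hc⟩) d
  refine ⟨f, ?_⟩
  rw [← hf, translate_eq_mapDomain, monomialBase_apply, Finsupp.mapDomain_smul,
    ← Finsupp.mapDomain_comp]
  rfl

/-- Take `M = -1` and `c = 2`: the affine maps are involutions, `1 - 2 ^ 2 = -3` is a unit, and the
coboundaries are the squares. -/
theorem exists_finite_of_coprime_six (n k : ℕ) (h : Nat.gcd n 6 = 1) :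
    ∃ φ : Lamplighter n k ≃* Lamplighter n k, reidemeisterNumber φ ≠ ⊤ := by
  have h2 : Nat.Coprime 2 n := (Nat.Coprime.coprime_dvd_right (by norm_num) h).symm
  have h3 : Nat.Coprime 3 n := (Nat.Coprime.coprime_dvd_right (by norm_num) h).symm
  let M : MulAut (Multiplicative (Fin k → ℤ)) := MulEquiv.inv _
  have hM : ∀ z, M z = z⁻¹ := fun _ => rfl
  refine ⟨monomialAut M (ZMod.unitOfCoprime 2 h2), ?_⟩
  rw [reidemeisterNumber_monomialAut M _ 2 (fun x y => by simp [hM])]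
  · have := finite_quotient_of_pow_mem (coboundaries M) two_ne_zero fun z =>
      mem_coboundaries.2 ⟨z, by rw [hM, div_inv_eq_mul, sq]⟩
    exact ENat.card_lt_top_of_finite.ne
  · rw [ZMod.coe_unitOfCoprime]
    have : (1 - ((2 : ℕ) : ZMod n) ^ 2) = -((ZMod.unitOfCoprime 3 h3 : (ZMod n)ˣ) : ZMod n) := by
      rw [ZMod.coe_unitOfCoprime]
      push_cast
      ring
    rw [this]
    exact (Units.isUnit _).neg

/-- An automorphism of `ℤ^(2l)` satisfying `1 + M + M² = 0`. -/
theorem exists_mulAut_mul_eq_one (l : ℕ) :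
    ∃ M : MulAut (Multiplicative (Fin (2 * l) → ℤ)), ∀ y, y * M y * M (M y) = 1 := by
  -- Multiplication by a primitive cube root of unity `ω` on ℤ[ω]^l, in the basis `1, ω`.
  let μ : ((Fin l → ℤ) × (Fin l → ℤ)) ≃+ ((Fin l → ℤ) × (Fin l → ℤ)) :=
    { toFun := fun v => (-v.2, v.1 - v.2)
      invFun := fun v => (v.2 - v.1, -v.1)
      left_inv := fun v => by ext <;> simp
      right_inv := fun v => by ext <;> simp
      map_add' := fun v w => by ext <;> simp <;> ring }
  have hμ : ∀ v, v + μ v + μ (μ v) = 0 := fun v => by ext <;> simp [μ] <;> ring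
  let e : (Fin (2 * l) → ℤ) ≃+ ((Fin l → ℤ) × (Fin l → ℤ)) :=
    ((LinearEquiv.funCongrLeft ℤ ℤ
      (finSumFinEquiv.trans (finCongr (two_mul l).symm))).trans
      (LinearEquiv.sumArrowLequivProdArrow (Fin l) (Fin l) ℤ ℤ)).toAddEquiv
  refine ⟨AddEquiv.toMultiplicative ((e.trans μ).trans e.symm), fun y => ?_⟩
  apply Multiplicative.toAdd.injective
  change Multiplicative.toAdd y + e.symm (μ (e (Multiplicative.toAdd y))) +
    e.symm (μ (e (e.symm (μ (e (Multiplicative.toAdd y)))))) = 0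
  apply e.injective
  simpa using hμ (e (Multiplicative.toAdd y))

/-- Since `1 + M + M² = 0`, every affine map `y ↦ x * M y` has cube the identity; with `c = -1` the
required unit is `1 - (-1) ^ 3 = 2`. -/
theorem exists_finite_of_odd_of_even {n : ℕ} (hn : Nat.Coprime 2 n) (l : ℕ) :
    ∃ φ : Lamplighter n (2 * l) ≃* Lamplighter n (2 * l), reidemeisterNumber φ ≠ ⊤ := by
  obtain ⟨M, hM⟩ := exists_mulAut_mul_eq_one l
  have hM2 : ∀ y, M (M y) = (y * M y)⁻¹ := fun y => (inv_eq_of_mul_eq_one_right (hM y)).symm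
  refine ⟨monomialAut M (-1), ?_⟩
  rw [reidemeisterNumber_monomialAut M _ 3 (fun x y => ?_)]
  · have := finite_quotient_of_pow_mem (coboundaries M) three_ne_zero fun z =>
      -- The witness comes from `(1 - M)(2 + M) = 2 - M - M² = 3`.
      mem_coboundaries.2 ⟨z ^ 2 * M z, by
        have h : M z ^ 2 * (z * M z)⁻¹ = z⁻¹ * M z := by
          rw [mul_inv, sq, mul_left_comm, mul_inv_cancel_right]
        rw [map_mul, map_pow, hM2, h, div_eq_iff_eq_mul, pow_succ z 2, mul_assoc,
          mul_inv_cancel_left]⟩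
    exact ENat.card_lt_top_of_finite.ne
  · have : (1 - (((-1 : (ZMod n)ˣ)) : ZMod n) ^ 3) = (ZMod.unitOfCoprime 2 hn : (ZMod n)ˣ) := by
      rw [ZMod.coe_unitOfCoprime]
      push_cast
      ring
    rw [this]
    exact Units.isUnit _
  · simp only [Function.iterate_succ, Function.iterate_zero, Function.comp_apply, id, map_mul, hM2,
      map_inv]
    simp [mul_comm, mul_left_comm]

end Existence

end TwistedBurnside

end

theorem mainTheorem8 :
    (∀ k n : ℕ, 0 < k → 0 < n → Nat.gcd n 2 = 1 →
      TwistedBurnside.TBFTf (TwistedBurnside.Lamplighter (3 * n) (2 * k))) ∧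
    (∀ k n : ℕ, 0 < k → 0 < n → Nat.gcd n 6 = 1 →
      TwistedBurnside.TBFTf (TwistedBurnside.Lamplighter n k)) ∧
    (∀ k n : ℕ, 0 < k → 0 < n →
      ((∃ φ : TwistedBurnside.Lamplighter n k ≃* TwistedBurnside.Lamplighter n k,
          TwistedBurnside.reidemeisterNumber φ ≠ ⊤) ↔
        ((∃ m l : ℕ, Nat.gcd m 2 = 1 ∧ n = 3 * m ∧ k = 2 * l) ∨ Nat.gcd n 6 = 1))) := by
  refine ⟨fun k n hk hn _ => TwistedBurnside.tbftf_lamplighter (by omega) (by omega),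
    fun k n hk hn _ => TwistedBurnside.tbftf_lamplighter hk hn, fun k n hk hn => ⟨?_, ?_⟩⟩
  · rintro ⟨φ, hR⟩
    have h2 := TwistedBurnside.not_two_dvd_of_finite hk hn hR
    by_cases h3 : 3 ∣ n
    · left
      obtain ⟨l, hl⟩ := TwistedBurnside.even_of_finite_of_three_dvd hn hR h3
      obtain ⟨m, rfl⟩ := h3
      refine ⟨m, l, ?_, rfl, by omega⟩
      exact Nat.coprime_two_right.2 (Nat.not_even_iff_odd.1 fun h =>
        h2 (h.two_dvd.mul_left 3))
    · right
      exact Nat.Coprime.mul_right (k := n) (m := 2) (n := 3)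
        ((Nat.Prime.coprime_iff_not_dvd Nat.prime_two).2 h2).symm
        ((Nat.Prime.coprime_iff_not_dvd Nat.prime_three).2 h3).symm
  · rintro (⟨m, l, hm, rfl, rfl⟩ | h)
    · exact TwistedBurnside.exists_finite_of_odd_of_even
        (Nat.Coprime.mul_right (by norm_num) (Nat.Coprime.symm hm)) l
    · exact TwistedBurnside.exists_finite_of_coprime_six n k h
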